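/- Let $J_m$ denote the $m\times m$ upper triangular nilpotent Jordan block (ones on the first superdiagonal, zeros elsewhere). Let $0\le k<n$ be integers, let $A=J_n\oplus J_n\oplus J_k$ acting on $\mathbb C^n\oplus\mathbb C^n\oplus\mathbb C^k$, and let $Q=(Q^{ij})_{1\le i,j\le 3}$ be any complex matrix on this space, written in blocks, with $Q^{ij}$ the block in block row $i$ and block column $j$. Put $A_\varepsilon=A+\varepsilon Q$ for $\varepsilon>0$. Let $Q^{ij}_{n1}$ be the entry of $Q^{ij}$ in row $n$ and column $1$, and suppose that the $2\times 2$ matrix $(Q^{ij}_{n1})_{1\le i,j\le 2}$ has two distinct eigenvalues $q_1\ne q_2$. With $n$, $k$ and $Q$ fixed, for all sufficiently small $\varepsilon>0$ the $2n+k$ eigenvalues of $A_\varepsilon$, counted with algebraic multiplicity, can be listed as $\lambda^j_\ell(\varepsilon)$, $j=1,2$, $1\le\ell\le n$, and $\nu_1(\varepsilon),\dots,\nu_k(\varepsilon)$, such that the $\lambda^j_\ell$ are $2n$ eigenvalues of largest modulus, i.e. $|\nu_m(\varepsilon)|\le|\lambda^j_\ell(\varepsilon)|$ for all $m,j,\ell$,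 and, as $\varepsilon\to0^+$, $$\lambda^j_\ell(\varepsilon)=\varepsilon^{1/n}\,|q_j|^{1/n}\,e^{i(2\pi\ell+\arg q_j)/n}+o(\varepsilon^{1/n}),\qquad 1\le\ell\le n,\ j=1,2,$$ while the remaining eigenvalues satisfy $\nu_m(\varepsilon)=o(\varepsilon^{1/n})$, $1\le m\le k$. (If $q_j=0$, then $|q_j|^{1/n}=0$ and the leading term is $0$.) -/

import Mathlib

open Filter Topology Asymptotics

/-- The `n × n` upper triangular nilpotent Jordan block: ones on the first superdiagonal and zeros
elsewhere. -/
def jordanBlock (n : ℕ) : Matrix (Fin n) (Fin n) ℂ :=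
  Matrix.of fun i j => if (j : ℕ) = (i : ℕ) + 1 then 1 else 0

/-- The index set of `ℂⁿ ⊕ ℂⁿ ⊕ ℂᵏ`. -/
abbrev TripleIndex (n k : ℕ) : Type := (Fin n ⊕ Fin n) ⊕ Fin k

/-- The block diagonal matrix `A = J_n ⊕ J_n ⊕ J_k`. -/
def jordanTriple (n k : ℕ) : Matrix (TripleIndex n k) (TripleIndex n k) ℂ :=
  Matrix.fromBlocks
    (Matrix.fromBlocks (jordanBlock n) 0 0 (jordanBlock n)) 0
    0 (jordanBlock k)

/-- The matrix `A_ε = A + ε Q`. -/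
def perturbedTriple (n k : ℕ) (Q : Matrix (TripleIndex n k) (TripleIndex n k) ℂ) (ε : ℝ) :
    Matrix (TripleIndex n k) (TripleIndex n k) ℂ :=
  jordanTriple n k + (ε : ℂ) • Q

/-- The inclusion of the coordinates of the `i`-th copy of `ℂⁿ` in `ℂⁿ ⊕ ℂⁿ ⊕ ℂᵏ`, `i = 1, 2`. -/
def copyIndex (n k : ℕ) (i : Fin 2) (a : Fin n) : TripleIndex n k :=
  Sum.inl (if i = 0 then Sum.inl a else Sum.inr a)

/-- The `2 × 2` matrix `(Q^{ij}_{n1})`, where `Q^{ij}` is the block of `Q` in block row `i` and block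
column `j`; its `(i, j)` entry is the entry of `Q^{ij}` in the last row and the first column. -/
def cornerMatrix (n k : ℕ) (hn : 0 < n) (Q : Matrix (TripleIndex n k) (TripleIndex n k) ℂ) :
    Matrix (Fin 2) (Fin 2) ℂ :=
  Matrix.of fun i j => Q (copyIndex n k i ⟨n - 1, by omega⟩) (copyIndex n k j ⟨0, hn⟩)

/-- The leading term `ε^{1/n} |q|^{1/n} e^{i (2 π ℓ + arg q) / n}`. -/
noncomputable def leadingTerm (n : ℕ) (q : ℂ) (l : ℕ) (ε : ℝ) : ℂ :=
  ((ε ^ ((1 : ℝ) / n) : ℝ) : ℂ) * ((‖q‖ ^ ((1 : ℝ) / n) : ℝ) : ℂ) *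
    Complex.exp (Complex.I * (2 * Real.pi * l + Complex.arg q) / n)

/-! Put `δ = ε ^ (1/n)`. Conjugating `A_ε` by the diagonal matrix of powers of `δ` and dividing by
`δ` gives a matrix polynomial in `δ` (`perturbedTriple_mul_diagonal`). Its value at `δ = 0` is `A`
plus a perturbation of rank at most two, supported in the last rows of the two large blocks. The
identity `det (1 - W R) = det (1 - R W)` reduces its characteristic polynomial to a `2 × 2`
determinant, giving `(X ^ n - q₁) (X ^ n - q₂) X ^ k` (`charpoly_scaledTriple_zero`). Eigenvalues
depend continuously on the matrix, also when listed with the `k` smallest last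
(`exists_tendsto_listing`); multiplying by `δ` gives the expansions. -/

/-! ### Listings of multisets of complex numbers. -/

theorem Multiset.exists_map_sum_of_card (s : Multiset ℂ) {α β : Type*} [Fintype α] [Fintype β]
    (hs : s.card = Fintype.card α + Fintype.card β) :
    ∃ z : α ⊕ β → ℂ, (Finset.univ.val.map z = s) ∧
      ∀ a b, ‖z (Sum.inr b)‖ ≤ ‖z (Sum.inl a)‖ := by
  obtain ⟨l, rfl⟩ : ∃ l : List ℂ, (l : Multiset ℂ) = s := Quot.exists_rep s
  let N := Fintype.card β + Fintype.card α
  have hl : l.length = N := by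
    have : l.length = Fintype.card α + Fintype.card β := by simpa using hs
    omega
  let f : Fin N → ℂ := fun i => l.get (i.cast hl.symm)
  have hf : Finset.univ.val.map f = (l : Multiset ℂ) := by
    rw [Fin.univ_val_map, List.ofFn_congr hl.symm]
    simp [f, List.ofFn_getElem]
  let σ := Tuple.sort fun i => ‖f i‖
  have hmono : Monotone ((fun i => ‖f i‖) ∘ σ) := Tuple.monotone_sort _
  let e : α ⊕ β ≃ Fin N :=
    (Equiv.sumComm α β).trans
      ((Equiv.sumCongr (Fintype.equivFin β) (Fintype.equivFin α)).trans finSumFinEquiv)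
  refine ⟨fun i => f (σ (e i)), ?_, fun a b => hmono ?_⟩
  · rw [← hf, ← Multiset.map_univ_val_equiv (e.trans σ), Multiset.map_map]
    rfl
  · change Fin.castAdd _ _ ≤ Fin.natAdd _ _
    rw [Fin.le_def, Fin.val_castAdd, Fin.val_natAdd]
    omega

theorem Multiset.exists_perm_of_map_univ_eq {α γ : Type*} [Fintype α] {f g : α → γ}
    (h : Finset.univ.val.map f = Finset.univ.val.map g) : ∃ σ : Equiv.Perm α, f ∘ σ = g := by
  classical
  have hcard : ∀ c, Fintype.card {a // g a = c} = Fintype.card {a // f a = c} := by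
    intro c
    have := congrArg (Multiset.count c) h
    simp only [Multiset.count_map] at this
    simp only [Fintype.card_subtype, Finset.card_def, Finset.filter_val]
    simp only [eq_comm (a := c)] at this
    exact this.symm
  let σ : Equiv.Perm α := (Equiv.sigmaFiberEquiv g).symm.trans
    ((Equiv.sigmaCongrRight fun c => Fintype.equivOfCardEq (hcard c)).trans
      (Equiv.sigmaFiberEquiv f))
  refine ⟨σ, funext fun a => ?_⟩
  exact (Fintype.equivOfCardEq (hcard (g a)) ⟨a, rfl⟩).2

/-- A listing `w` of the same numbers as `z`, in which the entries over `β` are smallest in modulus,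
agrees with `z` up to a permutation of `α` if `z` vanishes on `β`. -/
theorem exists_perm_inl_of_map_univ_eq {α β : Type*} [Fintype α] [Fintype β] {w z : α ⊕ β → ℂ}
    (h : Finset.univ.val.map w = Finset.univ.val.map z)
    (hw : ∀ a b, ‖w (Sum.inr b)‖ ≤ ‖w (Sum.inl a)‖) (hz : ∀ b, z (Sum.inr b) = 0) :
    ∃ σ : Equiv.Perm α, w ∘ Sum.map σ id = z := by
  classical
  have hsplit : ∀ y : α ⊕ β → ℂ, Finset.univ.val.map y =
      Finset.univ.val.map (fun a => y (Sum.inl a)) +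
        Finset.univ.val.map (fun b => y (Sum.inr b)) := by
    intro y
    rw [← Finset.univ_disjSum_univ, Finset.val_disjSum]
    simp [Multiset.disjSum, Multiset.map_add, Multiset.map_map]
  -- If `w` were nonzero at some `b`, it would be nonzero on all of `α`, so `0` would occur fewer
  -- than `card β` times.
  have hw0 : ∀ b, w (Sum.inr b) = 0 := by
    intro b
    by_contra hb
    have hc := congrArg (Multiset.count 0) h
    rw [hsplit, hsplit, Multiset.count_add, Multiset.count_add] at hc
    have h1 : Multiset.count 0 (Finset.univ.val.map fun a => w (Sum.inl a)) = 0 := by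
      rw [Multiset.count_eq_zero]
      intro hm
      obtain ⟨a, -, ha⟩ := Multiset.mem_map.1 hm
      have := hw a b
      rw [ha, norm_zero] at this
      exact hb (norm_le_zero_iff.1 this)
    have h2 : Multiset.count 0 (Finset.univ.val.map fun b => z (Sum.inr b)) = Fintype.card β := by
      simp [hz, Finset.card_univ]
    have h3 : Multiset.count 0 (Finset.univ.val.map fun b => w (Sum.inr b)) < Fintype.card β := by
      refine lt_of_le_of_ne ?_ fun he => ?_
      · exact (Multiset.count_le_card _ _).trans (by simp [Finset.card_univ])
      · have : Multiset.count 0 (Finset.univ.val.map fun b => w (Sum.inr b)) =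
            (Finset.univ.val.map fun b => w (Sum.inr b)).card := by
          rw [he]; simp [Finset.card_univ]
        rw [Multiset.count_eq_card] at this
        exact hb (this _ (Multiset.mem_map_of_mem _ (Finset.mem_univ b))).symm
    omega
  rw [hsplit w, hsplit z] at h
  simp only [hw0, hz] at h
  obtain ⟨σ, hσ⟩ := Multiset.exists_perm_of_map_univ_eq (add_right_cancel h)
  refine ⟨σ, funext fun i => ?_⟩
  rcases i with a | b
  · exact congrFun hσ a
  · simp [hw0, hz]

/-! ### Continuity of eigenvalues. -/

theorem Matrix.norm_le_of_mem_charpoly_roots {m : Type*} [Fintype m] [DecidableEq m]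
    {M : Matrix m m ℂ} {C : ℝ} (hC : ∀ i j, ‖M i j‖ ≤ C) {x : ℂ} (hx : x ∈ M.charpoly.roots) :
    ‖x‖ ≤ Fintype.card m * C := by
  have hx' : Module.End.HasEigenvalue (Matrix.toLin' M) x := by
    rw [Module.End.hasEigenvalue_iff_isRoot_charpoly, Matrix.charpoly_toLin']
    exact Polynomial.isRoot_of_mem_roots hx
  obtain ⟨v, hv⟩ := hx'.exists_hasEigenvector
  have hv0 := hv.2
  have hne : Nonempty m := by
    by_contra hm
    rw [not_nonempty_iff] at hm
    exact hv0 (Subsingleton.elim _ _)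
  obtain ⟨i, -, hi⟩ := Finset.exists_max_image Finset.univ (fun i => ‖v i‖) Finset.univ_nonempty
  have hpos : 0 < ‖v i‖ := by
    rw [norm_pos_iff]
    intro h0
    refine hv0 (funext fun j => norm_le_zero_iff.1 ?_)
    simpa [h0] using hi j (Finset.mem_univ j)
  have he : ∑ j, M i j * v j = x * v i := by
    simpa [Matrix.mulVec, dotProduct] using congrFun hv.apply_eq_smul i
  refine le_of_mul_le_mul_right ?_ hpos
  rw [← norm_mul, ← he]
  refine (norm_sum_le _ _).trans ((Finset.sum_le_card_nsmul _ _ (C * ‖v i‖) fun j _ => ?_).trans ?_)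
  · rw [norm_mul]
    exact mul_le_mul (hC i j) (hi j (Finset.mem_univ j)) (norm_nonneg _)
      ((norm_nonneg _).trans (hC i j))
  · simp [Finset.card_univ, mul_assoc]

theorem Matrix.charpoly_eq_prod_of_roots {m ι : Type*} [Fintype m] [DecidableEq m] [Fintype ι]
    {M : Matrix m m ℂ} {z : ι → ℂ} (hz : Finset.univ.val.map z = M.charpoly.roots) :
    M.charpoly = ∏ i, (Polynomial.X - Polynomial.C (z i)) := by
  have := (IsAlgClosed.splits M.charpoly).eq_prod_roots_of_monic M.charpoly_monic
  rw [this, ← hz, Multiset.map_map]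
  rfl

/-- Continuity of the eigenvalues, listed so that those over `β` are smallest in modulus. -/
theorem eventually_exists_listing_mem {X m α β : Type*} [Fintype m] [DecidableEq m] [Fintype α]
    [Fintype β] {l : Filter X} {M : X → Matrix m m ℂ} {M₀ : Matrix m m ℂ}
    (hM : Tendsto M l (𝓝 M₀)) (z₀ : α ⊕ β → ℂ) (hz₀ : ∀ b, z₀ (Sum.inr b) = 0)
    (hroots : M₀.charpoly.roots = Finset.univ.val.map z₀) {U : Set (α ⊕ β → ℂ)} (hU : U ∈ 𝓝 z₀) :
    ∀ᶠ x in l, ∃ z : α ⊕ β → ℂ, (Finset.univ.val.map z = (M x).charpoly.roots ∧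
      ∀ a b, ‖z (Sum.inr b)‖ ≤ ‖z (Sum.inl a)‖) ∧ z ∈ U := by
  by_contra hcon
  obtain ⟨F, hF'⟩ := Filter.exists_ultrafilter_iff.2
    (frequently_mem_iff_neBot.1 (not_eventually.1 hcon))
  obtain ⟨hFl, hF⟩ := le_inf_iff.1 hF'
  replace hF : ∀ᶠ x in (F : Filter X), ¬ _ := le_principal_iff.1 hF
  have hMF : Tendsto M F (𝓝 M₀) := hM.mono_left hFl
  have hcard : ∀ N : Matrix m m ℂ, N.charpoly.roots.card = Fintype.card α + Fintype.card β := by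
    have h0 : ∀ N : Matrix m m ℂ, N.charpoly.roots.card = Fintype.card m := fun N => by
      rw [← (IsAlgClosed.splits N.charpoly).natDegree_eq_card_roots, N.charpoly_natDegree_eq_dim]
    intro N
    rw [h0 N, ← h0 M₀, hroots]
    simp
  choose z hz hzle using fun x => (M x).charpoly.roots.exists_map_sum_of_card (hcard (M x))
  obtain ⟨w, hw⟩ : ∃ w, Tendsto z F (𝓝 w) := by
    obtain ⟨C, hC⟩ : ∃ C : ℝ, ∀ᶠ x in (F : Filter X), ∀ i j, ‖M x i j‖ ≤ C := by
      obtain ⟨C, hC⟩ : ∃ C : ℝ, ∀ i j, ‖M₀ i j‖ < C := by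
        refine ⟨∑ i, ∑ j, ‖M₀ i j‖ + 1, fun i j => lt_add_of_le_of_pos ?_ one_pos⟩
        exact (Finset.single_le_sum (f := fun j => ‖M₀ i j‖) (fun _ _ => norm_nonneg _)
          (Finset.mem_univ j)).trans (Finset.single_le_sum (f := fun i => ∑ j, ‖M₀ i j‖)
            (fun _ _ => Finset.sum_nonneg fun _ _ => norm_nonneg _) (Finset.mem_univ i))
      refine ⟨C, eventually_all.2 fun i => eventually_all.2 fun j => ?_⟩
      have : Tendsto (fun x => ‖M x i j‖) F (𝓝 ‖M₀ i j‖) :=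
        ((tendsto_pi_nhds.1 (tendsto_pi_nhds.1 hMF i)) j).norm
      exact (this.eventually_lt_const (hC i j)).mono fun _ h => h.le
    have hK : IsCompact (Set.univ.pi fun _ : α ⊕ β =>
        Metric.closedBall (0 : ℂ) (Fintype.card m * C)) :=
      isCompact_univ_pi fun _ => isCompact_closedBall _ _
    have hmem : ∀ᶠ x in (F : Filter X), z x ∈ Set.univ.pi fun _ : α ⊕ β =>
        Metric.closedBall (0 : ℂ) (Fintype.card m * C) := by
      filter_upwards [hC] with x hx i _
      rw [mem_closedBall_zero_iff]
      refine Matrix.norm_le_of_mem_charpoly_roots hx ?_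
      rw [← hz x]
      exact Multiset.mem_map_of_mem _ (Finset.mem_univ i)
    obtain ⟨w, -, hw⟩ := hK.ultrafilter_le_nhds (F.map z) (by
      rw [le_principal_iff]; exact hmem)
    exact ⟨w, hw⟩
  have hwroots : Finset.univ.val.map w = M₀.charpoly.roots := by
    have hp : M₀.charpoly = ∏ i, (Polynomial.X - Polynomial.C (w i)) := by
      refine Polynomial.funext fun t => ?_
      refine tendsto_nhds_unique (f := fun x => (M x).charpoly.eval t) (l := (F : Filter X)) ?_ ?_
      · simp only [Matrix.eval_charpoly]
        exact ((Continuous.matrix_det (continuous_const.sub continuous_id)).tendsto M₀).comp hMF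
      · simp only [Matrix.charpoly_eq_prod_of_roots (hz _), Polynomial.eval_prod,
          Polynomial.eval_sub, Polynomial.eval_X, Polynomial.eval_C]
        exact tendsto_finsetProd _ fun i _ => tendsto_const_nhds.sub (tendsto_pi_nhds.1 hw i)
    rw [hp]
    have := Polynomial.roots_multiset_prod_X_sub_C (Finset.univ.val.map w)
    rw [Multiset.map_map] at this
    exact this.symm
  have hwle : ∀ a b, ‖w (Sum.inr b)‖ ≤ ‖w (Sum.inl a)‖ := fun a b =>
    le_of_tendsto_of_tendsto' (tendsto_pi_nhds.1 hw _).norm (tendsto_pi_nhds.1 hw _).norm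
      fun x => hzle x a b
  obtain ⟨σ, hσ⟩ := exists_perm_inl_of_map_univ_eq (hwroots.trans hroots) hwle hz₀
  have hlim : Tendsto (fun x => z x ∘ Sum.map σ id) F (𝓝 z₀) := by
    rw [← hσ]
    exact tendsto_pi_nhds.2 fun i => tendsto_pi_nhds.1 hw _
  obtain ⟨x, hxU, hx⟩ := ((hlim.eventually_mem hU).and hF).exists
  -- Only `α` is permuted, so the ordering by modulus survives.
  refine hx ⟨z x ∘ Sum.map σ id, ⟨?_, fun a b => hzle x _ _⟩, hxU⟩
  rw [← hz x, ← Multiset.map_map]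
  congr 1
  exact Multiset.map_univ_val_equiv (Equiv.sumCongr σ (Equiv.refl β))

/-- Each matrix has finitely many ordered listings; taking one nearest to `z₀` serves all
neighbourhoods at once. -/
theorem exists_tendsto_listing {X m α β : Type*} [Fintype m] [DecidableEq m] [Fintype α]
    [Fintype β] {l : Filter X} {M : X → Matrix m m ℂ} {M₀ : Matrix m m ℂ}
    (hM : Tendsto M l (𝓝 M₀)) (z₀ : α ⊕ β → ℂ) (hz₀ : ∀ b, z₀ (Sum.inr b) = 0)
    (hroots : M₀.charpoly.roots = Finset.univ.val.map z₀) :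
    ∃ z : X → α ⊕ β → ℂ, Tendsto z l (𝓝 z₀) ∧ ∀ᶠ x in l,
      Finset.univ.val.map (z x) = (M x).charpoly.roots ∧
        ∀ a b, ‖z x (Sum.inr b)‖ ≤ ‖z x (Sum.inl a)‖ := by
  classical
  let S : X → Set (α ⊕ β → ℂ) := fun x => {z | Finset.univ.val.map z = (M x).charpoly.roots ∧
    ∀ a b, ‖z (Sum.inr b)‖ ≤ ‖z (Sum.inl a)‖}
  have hfin : ∀ x, (S x).Finite := by
    intro x
    refine (Set.Finite.pi' fun _ : α ⊕ β =>
      (M x).charpoly.roots.toFinset.finite_toSet).subset fun z hz i => ?_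
    rw [Finset.mem_coe, Multiset.mem_toFinset, ← hz.1]
    exact Multiset.mem_map_of_mem _ (Finset.mem_univ i)
  have hmin : ∀ x, ∃ z : α ⊕ β → ℂ, (S x).Nonempty → z ∈ S x ∧ ∀ y ∈ S x, dist z z₀ ≤ dist y z₀ := by
    intro x
    by_cases hx : (S x).Nonempty
    · obtain ⟨z, hz, hzm⟩ := Set.exists_min_image (S x) (fun y => dist y z₀) (hfin x) hx
      exact ⟨z, fun _ => ⟨hz, hzm⟩⟩
    · exact ⟨z₀, fun h => absurd h hx⟩
  choose z hz using hmin
  refine ⟨z, Metric.tendsto_nhds.2 fun r hr => ?_, ?_⟩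
  · filter_upwards [eventually_exists_listing_mem hM z₀ hz₀ hroots (Metric.ball_mem_nhds z₀ hr)]
      with x ⟨y, hy, hyr⟩
    exact ((hz x ⟨y, hy⟩).2 y hy).trans_lt hyr
  · filter_upwards [eventually_exists_listing_mem hM z₀ hz₀ hroots univ_mem]
      with x ⟨y, hy, _⟩
    exact (hz x ⟨y, hy⟩).1

/-! ### Jordan blocks and rescaling. -/

theorem jordanBlock_mulVec_apply (n : ℕ) (v : Fin n → ℂ) (a : Fin n) :
    (jordanBlock n).mulVec v a = if h : (a : ℕ) + 1 < n then v ⟨a + 1, h⟩ else 0 := by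
  simp only [Matrix.mulVec, dotProduct, jordanBlock, Matrix.of_apply, ite_mul, one_mul, zero_mul]
  split_ifs with h
  · rw [Finset.sum_eq_single ⟨(a : ℕ) + 1, h⟩]
    · simp
    · intro b _ hb
      rw [if_neg fun hb' => hb (Fin.ext hb')]
    · simp
  · exact Finset.sum_eq_zero fun b _ => if_neg fun hb => h (by omega)

theorem charpoly_jordanBlock (n : ℕ) : (jordanBlock n).charpoly = Polynomial.X ^ n := by
  rw [Matrix.charpoly_of_isUpperTriangular]
  · simp [jordanBlock]
  · intro i j hij
    have : (j : ℕ) < i := hij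
    exact if_neg (by omega)

theorem charpoly_jordanTriple (n k : ℕ) :
    (jordanTriple n k).charpoly = Polynomial.X ^ n * Polynomial.X ^ n * Polynomial.X ^ k := by
  simp [jordanTriple, Matrix.charpoly_fromBlocks_zero₂₁, charpoly_jordanBlock]

/-- The position of an index within its block. -/
def blockPosition (n k : ℕ) : TripleIndex n k → ℕ :=
  Sum.elim (Sum.elim Fin.val Fin.val) Fin.val

theorem blockPosition_lt {n k : ℕ} (hkn : k < n) (s : TripleIndex n k) :
    blockPosition n k s < n := by
  rcases s with (a | a) | a
  exacts [a.2, a.2, a.2.trans hkn]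

theorem jordanTriple_apply_eq_zero_or (n k : ℕ) (s t : TripleIndex n k) :
    jordanTriple n k s t = 0 ∨ blockPosition n k t = blockPosition n k s + 1 := by
  rcases s with (a | a) | a <;> rcases t with (b | b) | b <;>
    simp [jordanTriple, jordanBlock, blockPosition, em']

/-- The matrix obtained from `A_ε`, `ε = δ ^ n`, by conjugating with the diagonal matrix of the
powers of `δ` given by the block positions, and dividing by `δ`. -/
def scaledTriple (n k : ℕ) (Q : Matrix (TripleIndex n k) (TripleIndex n k) ℂ) (δ : ℂ) :
    Matrix (TripleIndex n k) (TripleIndex n k) ℂ :=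
  Matrix.of fun s t => jordanTriple n k s t +
    δ ^ (n - 1 - blockPosition n k s + blockPosition n k t) * Q s t

theorem continuous_scaledTriple (n k : ℕ) (Q : Matrix (TripleIndex n k) (TripleIndex n k) ℂ) :
    Continuous (scaledTriple n k Q) :=
  continuous_matrix fun s t => by
    simp only [scaledTriple, Matrix.of_apply]
    fun_prop

theorem Matrix.charpoly_smul_eq_prod {m ι : Type*} [Fintype m] [DecidableEq m] [Fintype ι]
    {M : Matrix m m ℂ} {z : ι → ℂ} (hz : Finset.univ.val.map z = M.charpoly.roots)
    {c : ℂ} (hc : c ≠ 0) :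
    (c • M).charpoly = ∏ i, (Polynomial.X - Polynomial.C (c * z i)) := by
  have hcard : Fintype.card m = Fintype.card ι := by
    have := congrArg Multiset.card hz
    rw [← (IsAlgClosed.splits M.charpoly).natDegree_eq_card_roots,
      M.charpoly_natDegree_eq_dim] at this
    simpa using this.symm
  refine Polynomial.funext fun x => ?_
  have hfac : Matrix.scalar m x - c • M = c • (Matrix.scalar m (x / c) - M) := by
    rw [smul_sub]
    congr 1
    ext i j
    by_cases hij : i = j
    · simp [hij, mul_div_cancel₀ _ hc]
    · simp [hij]
  rw [Matrix.eval_charpoly, hfac, Matrix.det_smul, ← Matrix.eval_charpoly,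
    Matrix.charpoly_eq_prod_of_roots hz, hcard]
  simp only [Polynomial.eval_prod, Polynomial.eval_sub, Polynomial.eval_X, Polynomial.eval_C]
  rw [← Finset.card_univ, ← Finset.prod_const, ← Finset.prod_mul_distrib]
  refine Finset.prod_congr rfl fun i _ => ?_
  rw [mul_sub, mul_div_cancel₀ _ hc]

theorem perturbedTriple_mul_diagonal {n k : ℕ} (hkn : k < n)
    (Q : Matrix (TripleIndex n k) (TripleIndex n k) ℂ) {ε δ : ℝ} (h : δ ^ n = ε) :
    perturbedTriple n k Q ε * Matrix.diagonal (fun s => (δ : ℂ) ^ blockPosition n k s) =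
      Matrix.diagonal (fun s => (δ : ℂ) ^ blockPosition n k s) *
        ((δ : ℂ) • scaledTriple n k Q δ) := by
  ext s t
  -- This bound, from `k < n`, keeps the natural subtraction `n - 1 - blockPosition n k s` from
  -- truncating.
  have hs := blockPosition_lt hkn s
  have hQ : (δ : ℂ) ^ n * (δ : ℂ) ^ blockPosition n k t = (δ : ℂ) ^ blockPosition n k s *
      ((δ : ℂ) * (δ : ℂ) ^ (n - 1 - blockPosition n k s + blockPosition n k t)) := by
    rw [← pow_succ', ← pow_add, ← pow_add]
    congr 1
    omega
  have hJ : jordanTriple n k s t * (δ : ℂ) ^ blockPosition n k t =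
      (δ : ℂ) ^ blockPosition n k s * ((δ : ℂ) * jordanTriple n k s t) := by
    rcases jordanTriple_apply_eq_zero_or n k s t with h0 | h0
    · simp [h0]
    · rw [h0]; ring
  rw [Matrix.mul_diagonal, Matrix.diagonal_mul]
  simp only [perturbedTriple, scaledTriple, Matrix.add_apply, Matrix.smul_apply, Matrix.of_apply,
    smul_eq_mul, ← h, Complex.ofReal_pow]
  linear_combination hJ + Q s t * hQ

theorem roots_charpoly_perturbedTriple {n k : ℕ} (hkn : k < n)
    (Q : Matrix (TripleIndex n k) (TripleIndex n k) ℂ) {ε δ : ℝ} (h : δ ^ n = ε) (hδ : δ ≠ 0)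
    {ι : Type*} [Fintype ι] {z : ι → ℂ}
    (hz : Finset.univ.val.map z = (scaledTriple n k Q δ).charpoly.roots) :
    (perturbedTriple n k Q ε).charpoly.roots = Finset.univ.val.map fun i => (δ : ℂ) * z i := by
  have hδ' : (δ : ℂ) ≠ 0 := Complex.ofReal_ne_zero.2 hδ
  set D := Matrix.diagonal (fun s => (δ : ℂ) ^ blockPosition n k s) with hD
  have hdet : D.det ≠ 0 := by
    rw [hD, Matrix.det_diagonal]
    exact Finset.prod_ne_zero_iff.2 fun s _ => pow_ne_zero _ hδ'
  have hchar : (perturbedTriple n k Q ε).charpoly = ((δ : ℂ) • scaledTriple n k Q δ).charpoly := by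
    refine Polynomial.funext fun x => ?_
    rw [Matrix.eval_charpoly, Matrix.eval_charpoly]
    refine mul_right_cancel₀ hdet ?_
    rw [← Matrix.det_mul, mul_comm, ← Matrix.det_mul, sub_mul, mul_sub,
      perturbedTriple_mul_diagonal hkn Q h,
      (Matrix.scalar_commute x (fun r => mul_comm x r) D).eq]
  rw [hchar, Matrix.charpoly_smul_eq_prod hz hδ']
  have := Polynomial.roots_multiset_prod_X_sub_C (Finset.univ.val.map fun i => (δ : ℂ) * z i)
  rw [Multiset.map_map] at this
  exact this

/-! ### The spectrum of the limit matrix. -/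

theorem charpoly_cornerMatrix_coeffs {C : Matrix (Fin 2) (Fin 2) ℂ} {q : Fin 2 → ℂ}
    (hq : ∀ j, Module.End.HasEigenvalue (Matrix.toLin' C) (q j)) (hne : q 0 ≠ q 1) :
    C 0 0 + C 1 1 = q 0 + q 1 ∧ C 0 0 * C 1 1 - C 0 1 * C 1 0 = q 0 * q 1 := by
  have h : ∀ j, (q j - C 0 0) * (q j - C 1 1) - C 0 1 * C 1 0 = 0 := by
    intro j
    have := (Module.End.hasEigenvalue_iff_isRoot_charpoly _ _).1 (hq j)
    rw [Matrix.charpoly_toLin', Polynomial.IsRoot.def, Matrix.eval_charpoly,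
      Matrix.det_fin_two] at this
    simpa using this
  have h1 : C 0 0 + C 1 1 = q 0 + q 1 := by
    -- The difference of the two characteristic equations is divisible by `q 0 - q 1`; distinctness
    -- is needed here.
    refine mul_left_cancel₀ (sub_ne_zero.2 hne) ?_
    linear_combination h 1 - h 0
  exact ⟨h1, by linear_combination h 0 + q 0 * h1⟩

section LimitMatrix

variable (n k : ℕ)

/-- The solution `v` of `(x - J_n) v = e_n`. -/
noncomputable def resolventColumn (x : ℂ) (a : Fin n) : ℂ := x⁻¹ ^ (n - (a : ℕ))

theorem resolventColumn_spec {x : ℂ} (hx : x ≠ 0) (a : Fin n) :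
    x * resolventColumn n x a - (jordanBlock n).mulVec (resolventColumn n x) a =
      if (a : ℕ) = n - 1 then 1 else 0 := by
  rw [jordanBlock_mulVec_apply]
  have ha := a.2
  obtain ⟨r, hr⟩ : ∃ r, n - (a : ℕ) = r + 1 := ⟨n - a - 1, by omega⟩
  have hw : x * resolventColumn n x a = x⁻¹ ^ r := by
    rw [resolventColumn, hr, pow_succ']
    field_simp
  rw [hw]
  split_ifs with h1 h2 h2
  · omega
  · rw [resolventColumn, show n - ((⟨(a : ℕ) + 1, h1⟩ : Fin n) : ℕ) = r by simp; omega, sub_self]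
  · rw [show r = 0 by omega]; simp
  · omega

/-- The columns `e_n` of the first two blocks. -/
def lastColumns : Matrix (TripleIndex n k) (Fin 2) ℂ :=
  Matrix.of fun s j => Sum.elim
    (Sum.elim (fun a : Fin n => if j = 0 then if (a : ℕ) = n - 1 then 1 else 0 else 0)
      (fun a : Fin n => if j = 1 then if (a : ℕ) = n - 1 then 1 else 0 else 0)) (fun _ => 0) s

/-- The solution `W` of `(x - A) W = U`, where `U` consists of the columns `e_n` of the first two
blocks. -/
noncomputable def resolventColumns (x : ℂ) : Matrix (TripleIndex n k) (Fin 2) ℂ :=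
  Matrix.of fun s j => Sum.elim
    (Sum.elim (fun a => if j = 0 then resolventColumn n x a else 0)
      (fun a => if j = 1 then resolventColumn n x a else 0)) (fun _ => 0) s

/-- The rows of `Q` with the last index of the first two blocks, restricted to the first column of
each block. -/
def cornerRows {n k : ℕ} (hn : 0 < n) (Q : Matrix (TripleIndex n k) (TripleIndex n k) ℂ) :
    Matrix (Fin 2) (TripleIndex n k) ℂ :=
  Matrix.of fun i t =>
    if blockPosition n k t = 0 then Q (copyIndex n k i ⟨n - 1, by omega⟩) t else 0

theorem sub_jordanTriple_mul_resolventColumns {x : ℂ} (hx : x ≠ 0) :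
    (Matrix.scalar _ x - jordanTriple n k) * resolventColumns n k x = lastColumns n k := by
  have key := resolventColumn_spec n hx
  simp only [Matrix.mulVec, dotProduct] at key
  ext s j
  rw [Matrix.sub_mul, Matrix.sub_apply, Matrix.scalar_apply, Matrix.diagonal_mul, Matrix.mul_apply]
  fin_cases j <;> rcases s with (a | a) | a <;>
    simp [jordanTriple, resolventColumns, lastColumns, Fintype.sum_sum_type, key]

/-- The exponent of `δ` vanishes only at row position `n - 1` and column position `0`; as `k < n`,
the small block has no such row. -/
theorem scaledTriple_zero {n k : ℕ} (hkn : k < n)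
    (Q : Matrix (TripleIndex n k) (TripleIndex n k) ℂ) :
    scaledTriple n k Q 0 =
      jordanTriple n k + lastColumns n k * cornerRows (Nat.zero_lt_of_lt hkn) Q := by
  have hn := Nat.zero_lt_of_lt hkn
  ext s t
  rw [Matrix.add_apply, scaledTriple, Matrix.of_apply, Matrix.mul_apply, Fin.sum_univ_two]
  congr 1
  have hlast : ∀ a : Fin n, (a : ℕ) = n - 1 → a = ⟨n - 1, by omega⟩ := fun a h => Fin.ext h
  rcases s with (a | a) | a
  · by_cases ha : (a : ℕ) = n - 1
    · rw [hlast a ha]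
      simp [lastColumns, cornerRows, copyIndex, blockPosition, zero_pow_eq]
    · have : n - 1 - (a : ℕ) ≠ 0 := by have := a.2; omega
      simp [lastColumns, ha, blockPosition, this]
  · by_cases ha : (a : ℕ) = n - 1
    · rw [hlast a ha]
      simp [lastColumns, cornerRows, copyIndex, blockPosition, zero_pow_eq]
    · have : n - 1 - (a : ℕ) ≠ 0 := by have := a.2; omega
      simp [lastColumns, ha, blockPosition, this]
  · have : n - 1 - (a : ℕ) ≠ 0 := by have := a.2; omega
    simp [lastColumns, blockPosition, this]

/-- The entries of `Q` in the first column of the small block drop out because `resolventColumns`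
vanishes on that block. -/
theorem cornerRows_mul_resolventColumns {n k : ℕ} (hn : 0 < n)
    (Q : Matrix (TripleIndex n k) (TripleIndex n k) ℂ) (x : ℂ) :
    cornerRows hn Q * resolventColumns n k x = x⁻¹ ^ n • cornerMatrix n k hn Q := by
  have key : ∀ f : Fin n → ℂ, (∑ a : Fin n,
      (if (a : ℕ) = 0 then f a else 0) * resolventColumn n x a) = (x ^ n)⁻¹ * f ⟨0, hn⟩ := by
    intro f
    rw [Finset.sum_eq_single ⟨0, hn⟩]
    · simp [resolventColumn, mul_comm]
    · intro b _ hb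
      rw [if_neg fun h => hb (Fin.ext h), zero_mul]
    · simp
  ext i j
  rw [Matrix.mul_apply, Matrix.smul_apply, smul_eq_mul, cornerMatrix, Matrix.of_apply]
  fin_cases j <;>
    simp [cornerRows, resolventColumns, Fintype.sum_sum_type, blockPosition, copyIndex]
  · exact key fun a => Q _ (Sum.inl (Sum.inl a))
  · exact key fun a => Q _ (Sum.inl (Sum.inr a))

theorem charpoly_scaledTriple_zero {n k : ℕ} (hkn : k < n)
    (Q : Matrix (TripleIndex n k) (TripleIndex n k) ℂ) (q : Fin 2 → ℂ)
    (hq : ∀ j, Module.End.HasEigenvalue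
      (Matrix.toLin' (cornerMatrix n k (Nat.zero_lt_of_lt hkn) Q)) (q j))
    (hne : q 0 ≠ q 1) :
    (scaledTriple n k Q 0).charpoly =
      (∏ j, (Polynomial.X ^ n - Polynomial.C (q j))) * Polynomial.X ^ k := by
  -- The resolvent needs `x ≠ 0`, and agreement at all such `x` suffices.
  refine Polynomial.eq_of_infinite_eval_eq _ _
    ((Set.finite_singleton (0 : ℂ)).infinite_compl.mono fun x hx => ?_)
  have hx : x ≠ 0 := hx
  obtain ⟨htr, hdet⟩ := charpoly_cornerMatrix_coeffs hq hne
  have hfac : Matrix.scalar _ x - scaledTriple n k Q 0 = (Matrix.scalar _ x - jordanTriple n k) *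
      (1 - resolventColumns n k x * cornerRows (Nat.zero_lt_of_lt hkn) Q) := by
    rw [mul_sub, mul_one, ← Matrix.mul_assoc, sub_jordanTriple_mul_resolventColumns n k hx,
      scaledTriple_zero hkn, sub_add_eq_sub_sub]
  rw [Set.mem_ofPred_eq, Matrix.eval_charpoly, hfac, Matrix.det_mul, ← Matrix.eval_charpoly,
    charpoly_jordanTriple, Matrix.det_one_sub_mul_comm, cornerRows_mul_resolventColumns,
    Matrix.det_fin_two]
  simp only [Matrix.sub_apply, Matrix.smul_apply, smul_eq_mul, Matrix.one_apply, Fin.prod_univ_two,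
    Polynomial.eval_mul, Polynomial.eval_sub, Polynomial.eval_pow, Polynomial.eval_X,
    Polynomial.eval_C, Fin.isValue, if_true, zero_ne_one, one_ne_zero, if_false, zero_sub]
  have hy : x⁻¹ ^ n * x ^ n = 1 := by rw [← mul_pow, inv_mul_cancel₀ hx, one_pow]
  generalize x⁻¹ ^ n = y at hy
  generalize x ^ n = X at hy
  have e1 : X * X * y = X := by linear_combination X * hy
  have e2 : X * X * (y * y) = 1 := by linear_combination (X * y + 1) * hy
  linear_combination x ^ k * ((-X * X * y) * htr + X * X * y * y * hdet -
    (q 0 + q 1) * e1 + q 0 * q 1 * e2)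

end LimitMatrix

/-! ### Leading terms and conclusion. -/

theorem X_pow_sub_C_eq_prod_leadingTerm {n : ℕ} (hn : 0 < n) (q : ℂ) :
    (Polynomial.X ^ n - Polynomial.C q : Polynomial ℂ) =
      ∏ l : Fin n, (Polynomial.X - Polynomial.C (leadingTerm n q ((l : ℕ) + 1) 1)) := by
  have hn' : (n : ℂ) ≠ 0 := Nat.cast_ne_zero.2 hn.ne'
  -- The base root has `ℓ = 1`, since `Fin n` shifted by one runs over `1, …, n`; powers of a
  -- primitive root of unity give the others.
  have hpow : leadingTerm n q 1 1 ^ n = q := by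
    have h1 : ((‖q‖ ^ ((1 : ℝ) / n) : ℝ) : ℂ) ^ n = ‖q‖ := by
      rw [← Complex.ofReal_pow, one_div, Real.rpow_inv_natCast_pow (norm_nonneg _) hn.ne']
    rw [leadingTerm, mul_pow, mul_pow, h1, ← Complex.exp_nat_mul, mul_div_cancel₀ _ hn', mul_add,
      Complex.exp_add]
    rw [show Complex.I * (2 * (Real.pi : ℂ) * ((1 : ℕ) : ℂ)) = 2 * Real.pi * Complex.I by
      push_cast; ring, Complex.exp_two_pi_mul_I]
    simp only [Real.one_rpow, Complex.ofReal_one, one_pow, one_mul]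
    rw [mul_comm Complex.I]
    exact Complex.norm_mul_exp_arg_mul_I q
  rw [X_pow_sub_C_eq_prod (Complex.isPrimitiveRoot_exp n hn.ne') hn hpow, Finset.prod_range]
  refine Finset.prod_congr rfl fun l _ => ?_
  congr 2
  rw [leadingTerm, leadingTerm, ← Complex.exp_nat_mul, mul_left_comm, ← Complex.exp_add]
  congr 2
  push_cast
  ring

theorem leadingTerm_eq_mul (n : ℕ) (q : ℂ) (l : ℕ) (ε : ℝ) :
    leadingTerm n q l ε = ((ε ^ ((1 : ℝ) / n) : ℝ) : ℂ) * leadingTerm n q l 1 := by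
  simp [leadingTerm, mul_assoc]

theorem Asymptotics.isLittleO_ofReal_mul {X : Type*} {l : Filter X} {f : X → ℝ} {g : X → ℂ}
    (hg : Tendsto g l (𝓝 0)) : (fun x => (f x : ℂ) * g x) =o[l] f := by
  have h := (isBigO_refl (fun x => (f x : ℂ)) l).mul_isLittleO
    ((isLittleO_one_iff ℂ).2 hg)
  simp only [mul_one] at h
  exact h.trans_isBigO (isBigO_of_le _ fun x => by simp)

theorem proposition5p1 (n k : ℕ) (hkn : k < n)
    (Q : Matrix (TripleIndex n k) (TripleIndex n k) ℂ) (q : Fin 2 → ℂ)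
    (hq : ∀ j, Module.End.HasEigenvalue
      (Matrix.toLin' (cornerMatrix n k (Nat.zero_lt_of_lt hkn) Q)) (q j))
    (hne : q 0 ≠ q 1) :
    ∃ (lam : Fin 2 → Fin n → ℝ → ℂ) (nu : Fin k → ℝ → ℂ),
      (∀ᶠ ε : ℝ in 𝓝[>] 0,
        (perturbedTriple n k Q ε).charpoly.roots =
          (Finset.univ : Finset (Fin 2 × Fin n)).val.map (fun p => lam p.1 p.2 ε) +
            (Finset.univ : Finset (Fin k)).val.map (fun m => nu m ε) ∧
        ∀ (m : Fin k) (j : Fin 2) (l : Fin n), ‖nu m ε‖ ≤ ‖lam j l ε‖) ∧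
      (∀ (j : Fin 2) (l : Fin n),
        (fun ε : ℝ => lam j l ε - leadingTerm n (q j) ((l : ℕ) + 1) ε)
          =o[𝓝[>] 0] fun ε : ℝ => ε ^ ((1 : ℝ) / n)) ∧
      (∀ m : Fin k, nu m =o[𝓝[>] 0] fun ε : ℝ => ε ^ ((1 : ℝ) / n)) := by
  have hn := Nat.zero_lt_of_lt hkn
  -- The limit spectrum: leading terms at `ε = 1`, and `k` zeros.
  let z₀ : (Fin 2 × Fin n) ⊕ Fin k → ℂ :=
    Sum.elim (fun p => leadingTerm n (q p.1) ((p.2 : ℕ) + 1) 1) fun _ => 0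
  have hroots : (scaledTriple n k Q 0).charpoly.roots = Finset.univ.val.map z₀ := by
    rw [charpoly_scaledTriple_zero hkn Q q hq hne]
    have h := Polynomial.roots_multiset_prod_X_sub_C (Finset.univ.val.map z₀)
    rw [Multiset.map_map] at h
    rw [← h]
    congr 1
    change _ = ∏ i, (Polynomial.X - Polynomial.C (z₀ i))
    rw [Fintype.prod_sum_type, Fintype.prod_prod_type]
    simp only [z₀, Sum.elim_inl, Sum.elim_inr, X_pow_sub_C_eq_prod_leadingTerm hn]
    simp
  have hδ : Tendsto (fun ε : ℝ => ((ε ^ ((1 : ℝ) / n) : ℝ) : ℂ)) (𝓝[>] 0) (𝓝 0) := by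
    have h0 : (0 : ℝ) < 1 / n := by positivity
    have := ((Real.continuous_rpow_const h0.le).tendsto 0).mono_left (nhdsWithin_le_nhds (s := .Ioi 0))
    rw [Real.zero_rpow h0.ne'] at this
    exact (Complex.continuous_ofReal.tendsto' 0 0 Complex.ofReal_zero).comp this
  obtain ⟨z, hz, hzgood⟩ := exists_tendsto_listing
    (((continuous_scaledTriple n k Q).tendsto 0).comp hδ) z₀ (fun _ => rfl) hroots
  have hlim := fun i => tendsto_pi_nhds.1 hz i
  refine ⟨fun j l ε => ((ε ^ ((1 : ℝ) / n) : ℝ) : ℂ) * z ε (Sum.inl (j, l)),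
    fun m ε => ((ε ^ ((1 : ℝ) / n) : ℝ) : ℂ) * z ε (Sum.inr m), ?_, fun j l => ?_, fun m => ?_⟩
  · filter_upwards [hzgood, self_mem_nhdsWithin] with ε ⟨hε, hle⟩ hpos
    have hpos : 0 < ε := hpos
    refine ⟨?_, fun m j l => ?_⟩
    · rw [roots_charpoly_perturbedTriple hkn Q
        (by rw [one_div, Real.rpow_inv_natCast_pow hpos.le hn.ne'])
        (Real.rpow_pos_of_pos hpos (1 / (n : ℝ))).ne' hε,
        ← Finset.univ_disjSum_univ, Finset.val_disjSum]
      simp [Multiset.disjSum, Multiset.map_add, Multiset.map_map, Function.comp_def]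
    · rw [norm_mul, norm_mul]
      exact mul_le_mul_of_nonneg_left (hle _ _) (norm_nonneg _)
  · refine (isLittleO_ofReal_mul (tendsto_sub_nhds_zero_iff.2 (hlim (Sum.inl (j, l))))).congr_left
      fun ε => ?_
    rw [leadingTerm_eq_mul n _ _ ε, mul_sub]
    rfl
  · exact isLittleO_ofReal_mul (hlim (Sum.inr m))
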